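/- Let $M$ be a smooth (Hausdorff) $n$-manifold. A statistical manifold $(M,g,\nabla)$ consists of a smooth Riemannian metric $g$ and a smooth torsion-free affine connection $\nabla$ on $M$ such that the cubic form $Q(X,Y,Z)=(\nabla_X g)(Y,Z)$ is totally symmetric. Its dual connection $\nabla^*$ is the affine connection determined by $$X\,g(Y,Z)=g(\nabla_XY,Z)+g(Y,\nabla^*_XZ)$$ for all vector fields $X,Y,Z$; then $(M,g,\nabla^*)$ is again a statistical manifold, the dual statistical manifold. A statistical manifold $(M,g,\nabla)$ has an equiaffine structure if there is a volume form $\omega$ on $M$ (a smooth, nowhere vanishing $n$-form) with $\nabla\omega=0$; it has a local equiaffine structure if every point of $M$ has an open neighbourhood carrying a volume form $\omega$ with $\nabla\omega=0$. **Proposition 3.1.** Let $(M,g,\nabla)$ be a statistical manifold with dual statistical manifold $(M,g,\nabla^*)$. Then $(M,g,\nabla)$ has an equiaffine structure if and only if $(M,g,\nabla^*)$ has an equiaffine structure. Likewise, $(M,g,\nabla)$ has a local equiaffine structure if and only if $(M,g,\nabla^*)$ has a local equiaffine structure. -/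

import Mathlib

open Bundle
open scoped Manifold ContDiff Topology

noncomputable section

namespace StatGeom

variable {n : ℕ} {M : Type*} [TopologicalSpace M] [ChartedSpace (EuclideanSpace ℝ (Fin n)) M]
  [IsManifold (𝓡 n) ∞ M]

/-- Smooth Riemannian metrics on a smooth `n`-manifold `M`. -/
abbrev RiemMetric (n : ℕ) (M : Type*) [TopologicalSpace M]
    [ChartedSpace (EuclideanSpace ℝ (Fin n)) M] [IsManifold (𝓡 n) ∞ M] :=
  ContMDiffRiemannianMetric (𝓡 n) ∞ (EuclideanSpace ℝ (Fin n))
    (TangentSpace (𝓡 n) : M → Type _)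

/-- Affine connections on `M`: covariant derivatives on the tangent bundle. -/
abbrev AffineConnection (n : ℕ) (M : Type*) [TopologicalSpace M]
    [ChartedSpace (EuclideanSpace ℝ (Fin n)) M] [IsManifold (𝓡 n) ∞ M] :=
  CovariantDerivative (𝓡 n) (EuclideanSpace ℝ (Fin n)) (TangentSpace (𝓡 n) : M → Type _)

/-- The vector field `Y` is differentiable at `x`. -/
abbrev DifferentiableFieldAt (Y : Π x : M, TangentSpace (𝓡 n) x) (x : M) : Prop :=
  MDifferentiableAt (𝓡 n) ((𝓡 n).prod 𝓘(ℝ, EuclideanSpace ℝ (Fin n)))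
    (fun y ↦ TotalSpace.mk' (EuclideanSpace ℝ (Fin n)) y (Y y)) x

/-- The vector field `Y` is smooth at (that is, near) `x`. -/
abbrev SmoothFieldAt (Y : Π x : M, TangentSpace (𝓡 n) x) (x : M) : Prop :=
  ContMDiffAt (𝓡 n) ((𝓡 n).prod 𝓘(ℝ, EuclideanSpace ℝ (Fin n))) ∞
    (fun y ↦ TotalSpace.mk' (EuclideanSpace ℝ (Fin n)) y (Y y)) x

theorem RiemMetric.mdifferentiableAt_inner (g : RiemMetric n M) {x : M}
    {σ τ : Π x : M, TangentSpace (𝓡 n) x} (hσ : DifferentiableFieldAt σ x) (hτ : DifferentiableFieldAt τ x) :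
    MDifferentiableAt (𝓡 n) 𝓘(ℝ) (fun y ↦ g.inner y (σ y) (τ y)) x := by
  have h : MDifferentiableAt (𝓡 n) ((𝓡 n).prod 𝓘(ℝ))
      (fun m ↦ TotalSpace.mk' ℝ (E := Bundle.Trivial M ℝ) m (g.inner m (σ m) (τ m))) x := by
    apply MDifferentiableAt.clm_bundle_apply₂ (F₁ := EuclideanSpace ℝ (Fin n)) (F₂ := EuclideanSpace ℝ (Fin n))
    · exact (g.contMDiff x).mdifferentiableAt (by simp)
    · exact hσ
    · exact hτ
  rw [mdifferentiableAt_totalSpace] at h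
  exact h.2

theorem RiemMetric.contMDiffAt_inner (g : RiemMetric n M) {x : M}
    {σ τ : Π x : M, TangentSpace (𝓡 n) x} (hσ : SmoothFieldAt σ x) (hτ : SmoothFieldAt τ x) :
    ContMDiffAt (𝓡 n) 𝓘(ℝ) ∞ (fun y ↦ g.inner y (σ y) (τ y)) x := by
  have h : ContMDiffAt (𝓡 n) ((𝓡 n).prod 𝓘(ℝ)) ∞
      (fun m ↦ TotalSpace.mk' ℝ (E := Bundle.Trivial M ℝ) m (g.inner m (σ m) (τ m))) x := by
    apply ContMDiffAt.clm_bundle_apply₂ (F₁ := EuclideanSpace ℝ (Fin n)) (F₂ := EuclideanSpace ℝ (Fin n))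
    · exact (g.contMDiff x)
    · exact hσ
    · exact hτ
  rw [contMDiffAt_totalSpace] at h
  exact h.2

/-- For vector fields `Y`, `Z`, the form `X ↦ (∇_X g)(Y, Z) = X g(Y, Z) - g(∇_X Y, Z) - g(Y, ∇_X Z)`
at the point `x`. -/
def covDerivMetricAux (g : RiemMetric n M) (cov : AffineConnection n M)
    (Y Z : Π x : M, TangentSpace (𝓡 n) x) (x : M) : TangentSpace (𝓡 n) x →L[ℝ] ℝ :=
  mvfderiv (𝓡 n) (fun y ↦ g.inner y (Y y) (Z y)) x - g.inner x (Z x) ∘L cov Y x - g.inner x (Y x) ∘L cov Z x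

theorem covDerivMetricAux_apply (g : RiemMetric n M) (cov : AffineConnection n M)
    (Y Z : Π x : M, TangentSpace (𝓡 n) x) (x : M) (X : TangentSpace (𝓡 n) x) :
    covDerivMetricAux g cov Y Z x X =
      mvfderiv (𝓡 n) (fun y ↦ g.inner y (Y y) (Z y)) x X - g.inner x (cov Y x X) (Z x)
        - g.inner x (Y x) (cov Z x X) := by
  rw [g.symm x (cov Y x X)]
  rfl

theorem covDerivMetricAux_symm (g : RiemMetric n M) (cov : AffineConnection n M)
    (Y Z : Π x : M, TangentSpace (𝓡 n) x) (x : M) :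
    covDerivMetricAux g cov Y Z x = covDerivMetricAux g cov Z Y x := by
  have : (fun y ↦ g.inner y (Y y) (Z y)) = (fun y ↦ g.inner y (Z y) (Y y)) := by
    funext y; exact g.symm y _ _
  unfold covDerivMetricAux
  rw [this]; abel

theorem tensorialAt_covDerivMetricAux (g : RiemMetric n M) (cov : AffineConnection n M) {x : M}
    (Z : Π x : M, TangentSpace (𝓡 n) x) (hZ : DifferentiableFieldAt Z x) :
    TensorialAt (𝓡 n) (EuclideanSpace ℝ (Fin n)) (covDerivMetricAux g cov · Z x) x where
  smul {f Y} hf hY := by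
    have h := g.mdifferentiableAt_inner hY hZ
    have e : (fun y ↦ g.inner y ((f • Y) y) (Z y)) = f * (fun y ↦ g.inner y (Y y) (Z y)) := by
      funext y; simp
    ext X
    rw [covDerivMetricAux_apply, e, mvfderiv_mul hf h, cov.isCovariantDerivativeOn.leibniz hY hf,
      smul_apply, covDerivMetricAux_apply]
    simp
    ring
  add {Y Y'} hY hY' := by
    have e : (fun y ↦ g.inner y ((Y + Y') y) (Z y)) =
        (fun y ↦ g.inner y (Y y) (Z y)) + (fun y ↦ g.inner y (Y' y) (Z y)) := by
      funext y; simp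
    ext X
    rw [covDerivMetricAux_apply, e, mvfderiv_add (g.mdifferentiableAt_inner hY hZ)
      (g.mdifferentiableAt_inner hY' hZ), cov.isCovariantDerivativeOn.add hY hY',
      add_apply (covDerivMetricAux g cov Y Z x), covDerivMetricAux_apply, covDerivMetricAux_apply]
    simp
    ring

/-- The tensor field `∇g`: `covDerivMetric g cov x Y Z X = (∇_X g)(Y, Z)`. -/
def covDerivMetric (g : RiemMetric n M) (cov : AffineConnection n M) (x : M) :
    TangentSpace (𝓡 n) x →L[ℝ] TangentSpace (𝓡 n) x →L[ℝ] TangentSpace (𝓡 n) x →L[ℝ] ℝ :=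
  TensorialAt.mkHom₂ (covDerivMetricAux g cov · · x) x
    (tensorialAt_covDerivMetricAux g cov)
    (fun Y hY ↦ by
      simpa only [covDerivMetricAux_symm g cov Y] using! tensorialAt_covDerivMetricAux g cov Y hY)

theorem covDerivMetric_apply (g : RiemMetric n M) (cov : AffineConnection n M) {x : M}
    {Y Z : Π x : M, TangentSpace (𝓡 n) x} (hY : DifferentiableFieldAt Y x) (hZ : DifferentiableFieldAt Z x)
    (X : TangentSpace (𝓡 n) x) :
    covDerivMetric g cov x (Y x) (Z x) X =
      mvfderiv (𝓡 n) (fun y ↦ g.inner y (Y y) (Z y)) x X - g.inner x (cov Y x X) (Z x)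
        - g.inner x (Y x) (cov Z x X) := by
  unfold covDerivMetric
  rw [TensorialAt.mkHom₂_apply _ _ hY hZ, covDerivMetricAux_apply]


instance instFiniteDimensionalTangentSpaceEuclidean (x : M) :
    FiniteDimensional ℝ (TangentSpace (𝓡 n) x) :=
  inferInstanceAs (FiniteDimensional ℝ (EuclideanSpace ℝ (Fin n)))

instance instT2SpaceTangentSpaceEuclidean (x : M) : T2Space (TangentSpace (𝓡 n) x) :=
  inferInstanceAs (T2Space (EuclideanSpace ℝ (Fin n)))

theorem RiemMetric.inner_ext (g : RiemMetric n M) {x : M} {u v : TangentSpace (𝓡 n) x}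
    (h : ∀ w, g.inner x u w = g.inner x v w) : u = v := by
  by_contra huv
  have := g.pos x (u - v) (sub_ne_zero.2 huv)
  rw [map_sub (g.inner x), sub_apply, h, sub_self] at this
  exact lt_irrefl _ this

theorem RiemMetric.exists_inner_eq (g : RiemMetric n M) (x : M)
    (ℓ : Module.Dual ℝ (TangentSpace (𝓡 n) x)) : ∃ v, ∀ w, g.inner x v w = ℓ w := by
  let L : TangentSpace (𝓡 n) x →ₗ[ℝ] Module.Dual ℝ (TangentSpace (𝓡 n) x) :=
    ContinuousLinearMap.coeLM ℝ ∘ₗ (g.inner x).toLinearMap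
  have hL : Function.Injective L := fun u v h ↦ g.inner_ext fun w ↦ congr($h w)
  obtain ⟨v, hv⟩ := (LinearMap.injective_iff_surjective_of_finrank_eq_finrank
    (Subspace.dual_finrank_eq (K := ℝ) (V := TangentSpace (𝓡 n) x)).symm).1 hL ℓ
  exact ⟨v, fun w ↦ congr($hv w)⟩

/-- Raising an index: the vector `v` with `g(v, w) = ℓ w` for all `w`. -/
def RiemMetric.sharp (g : RiemMetric n M) (x : M) (ℓ : Module.Dual ℝ (TangentSpace (𝓡 n) x)) :
    TangentSpace (𝓡 n) x :=
  (g.exists_inner_eq x ℓ).choose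

theorem RiemMetric.inner_sharp (g : RiemMetric n M) (x : M)
    (ℓ : Module.Dual ℝ (TangentSpace (𝓡 n) x)) (w : TangentSpace (𝓡 n) x) :
    g.inner x (g.sharp x ℓ) w = ℓ w :=
  (g.exists_inner_eq x ℓ).choose_spec w

/-- The vector `A(Y)(X)` with `g(A(Y)(X), Z) = (∇_X g)(Y, Z)` for all `Z`. -/
def dualTensorAux (g : RiemMetric n M) (cov : AffineConnection n M) (x : M)
    (Y X : TangentSpace (𝓡 n) x) : TangentSpace (𝓡 n) x :=
  g.sharp x
    { toFun := fun Z ↦ covDerivMetric g cov x Y Z X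
      map_add' := fun Z Z' ↦ by rw [map_add, add_apply]
      map_smul' := fun c Z ↦ by rw [map_smul, smul_apply, RingHom.id_apply] }

theorem inner_dualTensorAux (g : RiemMetric n M) (cov : AffineConnection n M) (x : M)
    (X Y Z : TangentSpace (𝓡 n) x) :
    g.inner x (dualTensorAux g cov x Y X) Z = covDerivMetric g cov x Y Z X :=
  g.inner_sharp x _ Z

/-- The tensor field `A` with `g(A(Y)(X), Z) = (∇_X g)(Y, Z)`. -/
def dualTensor (g : RiemMetric n M) (cov : AffineConnection n M) (x : M) :
    TangentSpace (𝓡 n) x →L[ℝ] TangentSpace (𝓡 n) x →L[ℝ] TangentSpace (𝓡 n) x :=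
  LinearMap.toContinuousBilinearMap <| LinearMap.mk₂ ℝ (dualTensorAux g cov x)
    (fun Y Y' X ↦ g.inner_ext fun Z ↦ by
      rw [map_add (g.inner x), add_apply]
      simp only [inner_dualTensorAux, (covDerivMetric g cov x).map_add Y Y', add_apply])
    (fun c Y X ↦ g.inner_ext fun Z ↦ by
      rw [map_smul (g.inner x), smul_apply]
      simp only [inner_dualTensorAux, (covDerivMetric g cov x).map_smul c Y, smul_apply])
    (fun Y X X' ↦ g.inner_ext fun Z ↦ by
      rw [map_add (g.inner x), add_apply]
      simp only [inner_dualTensorAux, map_add])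
    (fun c Y X ↦ g.inner_ext fun Z ↦ by
      rw [map_smul (g.inner x), smul_apply]
      simp only [inner_dualTensorAux, map_smul])

theorem inner_dualTensor (g : RiemMetric n M) (cov : AffineConnection n M) (x : M)
    (X Y Z : TangentSpace (𝓡 n) x) :
    g.inner x (dualTensor g cov x Y X) Z = covDerivMetric g cov x Y Z X :=
  inner_dualTensorAux g cov x X Y Z

/-- The dual connection `∇*`, characterized by `X g(Y, Z) = g(∇_X Y, Z) + g(Y, ∇*_X Z)`. -/
def dualConnection (g : RiemMetric n M) (cov : AffineConnection n M) : AffineConnection n M :=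
  cov.addOneForm (dualTensor g cov)

theorem dualConnection_apply (g : RiemMetric n M) (cov : AffineConnection n M)
    (Y : Π x : M, TangentSpace (𝓡 n) x) (x : M) :
    dualConnection g cov Y x = cov Y x + dualTensor g cov x (Y x) := rfl

/-- Duality: `X g(Y, Z) = g(∇_X Y, Z) + g(Y, ∇*_X Z)`. -/
theorem dualConnection_spec (g : RiemMetric n M) (cov : AffineConnection n M) {x : M}
    {Y Z : Π x : M, TangentSpace (𝓡 n) x} (hY : DifferentiableFieldAt Y x)
    (hZ : DifferentiableFieldAt Z x) (X : TangentSpace (𝓡 n) x) :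
    mvfderiv (𝓡 n) (fun y ↦ g.inner y (Y y) (Z y)) x X =
      g.inner x (cov Y x X) (Z x) + g.inner x (Y x) (dualConnection g cov Z x X) := by
  have h := covDerivMetric_apply g cov hZ hY X
  have e : (fun y ↦ g.inner y (Y y) (Z y)) = (fun y ↦ g.inner y (Z y) (Y y)) := by
    funext y; exact g.symm y _ _
  rw [dualConnection_apply, add_apply, map_add, g.symm x (Y x) (dualTensor g cov x (Z x) X),
    inner_dualTensor, h, e, g.symm x (cov Y x X), g.symm x (Y x)]
  ring

/-- The cubic form `Q(X, Y, Z) = (∇_X g)(Y, Z)`. -/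
def cubicForm (g : RiemMetric n M) (cov : AffineConnection n M) (x : M)
    (X Y Z : TangentSpace (𝓡 n) x) : ℝ :=
  covDerivMetric g cov x Y Z X

theorem covDerivMetric_symm (g : RiemMetric n M) (cov : AffineConnection n M) (x : M)
    (Y Z : TangentSpace (𝓡 n) x) :
    covDerivMetric g cov x Y Z = covDerivMetric g cov x Z Y := by
  unfold covDerivMetric
  rw [TensorialAt.mkHom₂_apply_eq_extend, TensorialAt.mkHom₂_apply_eq_extend]
  exact covDerivMetricAux_symm ..

theorem covDerivMetric_dualConnection (g : RiemMetric n M) (cov : AffineConnection n M) (x : M)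
    (X Y Z : TangentSpace (𝓡 n) x) :
    covDerivMetric g (dualConnection g cov) x Y Z X = - covDerivMetric g cov x Y Z X := by
  have hY : DifferentiableFieldAt (FiberBundle.extend (EuclideanSpace ℝ (Fin n)) Y) x :=
    FiberBundle.mdifferentiableAt_extend ..
  have hZ : DifferentiableFieldAt (FiberBundle.extend (EuclideanSpace ℝ (Fin n)) Z) x :=
    FiberBundle.mdifferentiableAt_extend ..
  have h := covDerivMetric_apply g cov hY hZ X
  have h' := covDerivMetric_apply g (dualConnection g cov) hY hZ X
  have s := covDerivMetric_symm g cov x Y Z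
  simp only [FiberBundle.extend_apply_self, dualConnection_apply, add_apply, map_add,
    inner_dualTensor] at h h'
  rw [g.symm x Y (dualTensor g cov x Z X), inner_dualTensor, ← s] at h'
  rw [h', h]
  linarith

theorem torsion_dualConnection (g : RiemMetric n M) (cov : AffineConnection n M)
    (ht : cov.torsion = 0)
    (hQ : ∀ (x : M) (X Y Z : TangentSpace (𝓡 n) x),
      cubicForm g cov x X Y Z = cubicForm g cov x Y X Z) :
    (dualConnection g cov).torsion = 0 := by
  rw [CovariantDerivative.torsion_eq_zero_iff] at ht ⊢
  intro X Y x hX hY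
  rw [← ht hX hY, dualConnection_apply, dualConnection_apply, add_apply, add_apply]
  have : dualTensor g cov x (Y x) (X x) = dualTensor g cov x (X x) (Y x) := by
    refine g.inner_ext fun w ↦ ?_
    rw [inner_dualTensor, inner_dualTensor]
    exact hQ x _ _ _
  rw [this]
  abel


/-! ### Smoothness of the dual connection -/

theorem contMDiffAt_mvfderiv_apply {x : M} {f : M → ℝ} (hf : ContMDiffAt (𝓡 n) 𝓘(ℝ) ∞ f x)
    {X : Π x : M, TangentSpace (𝓡 n) x} (hX : SmoothFieldAt X x) :
    ContMDiffAt (𝓡 n) 𝓘(ℝ) ∞ (fun y ↦ mvfderiv (𝓡 n) f y (X y)) x := by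
  have h := hf.mfderiv_const (m := ∞) (by simp)
  have h2 := ContMDiffAt.clm_apply_of_inCoordinates (b₁ := id) (b₂ := f)
    (E₁ := TangentSpace (𝓡 n)) (E₂ := TangentSpace 𝓘(ℝ)) (v := X) h hX hf
  rw [contMDiffAt_totalSpace] at h2
  refine h2.2.congr_of_eventuallyEq (.of_forall fun y ↦ ?_)
  simp [mvfderiv]
  rfl

set_option linter.unusedSectionVars false in
theorem contMDiffAt_clm {F F' : Type*} [NormedAddCommGroup F] [NormedSpace ℝ F]
    [FiniteDimensional ℝ F] [NormedAddCommGroup F'] [NormedSpace ℝ F'] {f : M → F →L[ℝ] F'}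
    {x : M} (h : ∀ u, ContMDiffAt (𝓡 n) 𝓘(ℝ, F') ∞ (fun y ↦ f y u) x) :
    ContMDiffAt (𝓡 n) 𝓘(ℝ, F →L[ℝ] F') ∞ f x := by
  let d := Module.finrank ℝ F
  have hd : d = Module.finrank ℝ (Fin d → ℝ) := (Module.finrank_fin_fun ℝ).symm
  let e₁ := ContinuousLinearEquiv.ofFinrankEq hd
  let e₂ := (e₁.arrowCongr (1 : F' ≃L[ℝ] F')).trans (ContinuousLinearEquiv.piRing (Fin d))
  rw [← Function.id_comp f, ← e₂.symm_comp_self]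
  exact e₂.symm.contDiff.contMDiff.contMDiffAt.comp x (contMDiffAt_pi_space.2 fun i ↦ h _)

/-- The field near `x₀` with constant coordinates `u` in the trivialization at `x₀`. -/
def coordField (x₀ : M) (u : EuclideanSpace ℝ (Fin n)) (y : M) : TangentSpace (𝓡 n) y :=
  (trivializationAt (EuclideanSpace ℝ (Fin n)) (TangentSpace (𝓡 n)) x₀).symmL ℝ y u

theorem smoothOn_coordField (x₀ : M) (u : EuclideanSpace ℝ (Fin n)) {y : M}
    (hy : y ∈ (trivializationAt (EuclideanSpace ℝ (Fin n)) (TangentSpace (𝓡 n)) x₀).baseSet) :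
    SmoothFieldAt (coordField x₀ u) y := by
  refine (Trivialization.contMDiffAt_section_iff _ hy).2 ?_
  refine contMDiffAt_const (c := u) |>.congr_of_eventuallyEq ?_
  filter_upwards [(Trivialization.open_baseSet _).mem_nhds hy] with z hz
  rw [coordField, Trivialization.symmL_apply _ hz, Trivialization.apply_mk_symm _ hz]

theorem exists_global_field [T2Space M] (x₀ : M) (u : EuclideanSpace ℝ (Fin n)) :
    ∃ Y : Π x : M, TangentSpace (𝓡 n) x, (∀ x, SmoothFieldAt Y x) ∧
      ∀ᶠ y in 𝓝 x₀, Y y = coordField x₀ u y := by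
  have hU := (trivializationAt (EuclideanSpace ℝ (Fin n)) (TangentSpace (𝓡 n)) x₀).open_baseSet
  have hx := FiberBundle.mem_baseSet_trivializationAt' (F := EuclideanSpace ℝ (Fin n))
    (E := TangentSpace (𝓡 n)) x₀
  obtain ⟨ψ, -, hψ⟩ := (SmoothBumpFunction.nhds_basis_tsupport (I := 𝓡 n) x₀).mem_iff.1
    (hU.mem_nhds hx)
  refine ⟨(ψ : M → ℝ) • coordField x₀ u, ?_, ?_⟩
  · exact ContMDiffOn.smul_section_of_tsupport ψ.contMDiff.contMDiffOn hU hψ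
      fun y hy ↦ (smoothOn_coordField x₀ u hy).contMDiffWithinAt
  · filter_upwards [ψ.eventuallyEq_one] with y hy
    simp [hy]

theorem RiemMetric.smoothFieldAt_of_inner (g : RiemMetric n M) {x₀ : M}
    {W : Π x : M, TangentSpace (𝓡 n) x}
    (h : ∀ u, ContMDiffAt (𝓡 n) 𝓘(ℝ) ∞ (fun y ↦ g.inner y (W y) (coordField x₀ u y)) x₀) :
    SmoothFieldAt W x₀ := by
  set t := trivializationAt (EuclideanSpace ℝ (Fin n)) (TangentSpace (𝓡 n) : M → Type _) x₀
    with ht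
  have hx : x₀ ∈ t.baseSet := FiberBundle.mem_baseSet_trivializationAt' x₀
  let G (y : M) : EuclideanSpace ℝ (Fin n) →L[ℝ] EuclideanSpace ℝ (Fin n) →L[ℝ] ℝ :=
    ContinuousLinearMap.inCoordinates (EuclideanSpace ℝ (Fin n)) (TangentSpace (𝓡 n) : M → Type _)
      (EuclideanSpace ℝ (Fin n) →L[ℝ] ℝ) (fun y ↦ TangentSpace (𝓡 n) y →L[ℝ] ℝ)
      x₀ y x₀ y (g.inner y)
  have hG : ContMDiffAt (𝓡 n) 𝓘(ℝ, EuclideanSpace ℝ (Fin n) →L[ℝ] EuclideanSpace ℝ (Fin n) →L[ℝ] ℝ) ∞ G x₀ := by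
    have := g.contMDiff x₀
    rw [contMDiffAt_hom_bundle] at this
    exact this.2
  have hGapp : ∀ y ∈ t.baseSet, ∀ u v, G y u v = g.inner y (t.symmL ℝ y u) (t.symmL ℝ y v) := by
    intro y hy u v
    have := inCoordinates_apply_eq₂ (𝕜 := ℝ) (F₁ := EuclideanSpace ℝ (Fin n))
      (F₂ := EuclideanSpace ℝ (Fin n)) (F₃ := ℝ) (E₁ := (TangentSpace (𝓡 n) : M → Type _))
      (E₂ := (TangentSpace (𝓡 n) : M → Type _)) (E₃ := Bundle.Trivial M ℝ)
      (ϕ := g.inner y) (x₀ := x₀) (x := y) (v := u) (w := v) hy hy (by simp)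
    rw [Trivialization.symmL_apply _ hy, Trivialization.symmL_apply _ hy]
    simpa using! this
  have hWc : ∀ y ∈ t.baseSet, t.symmL ℝ y (t ⟨y, W y⟩).2 = W y := by
    intro y hy
    rw [← Trivialization.continuousLinearMapAt_apply_of_mem (R := ℝ) t hy,
      Trivialization.symmL_continuousLinearMapAt _ hy]
  have hh : ContMDiffAt (𝓡 n) 𝓘(ℝ, EuclideanSpace ℝ (Fin n) →L[ℝ] ℝ) ∞ (fun y ↦ G y (t ⟨y, W y⟩).2) x₀ := by
    refine contMDiffAt_clm fun u ↦ (h u).congr_of_eventuallyEq ?_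
    filter_upwards [t.open_baseSet.mem_nhds hx] with y hy
    rw [hGapp y hy, hWc y hy]
    rfl
  have hinv : ∀ y ∈ t.baseSet, (G y).IsInvertible := by
    intro y hy
    have hinj : Function.Injective (G y).toLinearMap := by
      rw [← LinearMap.ker_eq_bot, LinearMap.ker_eq_bot']
      intro u hu
      by_contra hne
      have h0 : t.symmL ℝ y u ≠ 0 := fun h0 ↦ hne <| by
        rw [← Trivialization.continuousLinearMapAt_symmL (R := ℝ) t hy u, h0, map_zero]
      have := g.pos y _ h0
      rw [← hGapp y hy] at this
      have hu' : G y u = 0 := hu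
      rw [hu'] at this
      exact lt_irrefl _ this
    have hfr : Module.finrank ℝ (EuclideanSpace ℝ (Fin n)) =
        Module.finrank ℝ (EuclideanSpace ℝ (Fin n) →L[ℝ] ℝ) := by
      rw [← LinearMap.toContinuousLinearMap.finrank_eq]
      exact Subspace.dual_finrank_eq.symm
    let e := LinearEquiv.ofInjectiveOfFinrankEq (G y).toLinearMap hinj hfr
    exact ⟨e.toContinuousLinearEquiv, by ext; rfl⟩
  refine (contMDiffAt_section x₀).2 ?_
  have hGi : ContMDiffAt (𝓡 n) 𝓘(ℝ, (EuclideanSpace ℝ (Fin n) →L[ℝ] ℝ) →L[ℝ] EuclideanSpace ℝ (Fin n)) ∞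
      (fun y ↦ (G y).inverse) x₀ :=
    (hinv x₀ hx).contDiffAt_map_inverse.contMDiffAt.comp x₀ hG
  refine (ContMDiffAt.clm_apply hGi hh).congr_of_eventuallyEq ?_
  filter_upwards [t.open_baseSet.mem_nhds hx] with y hy
  exact ((hinv y hy).inverse_apply_self _).symm


theorem RiemMetric.contMDiffAt_hom_of_inner (g : RiemMetric n M) {x₀ : M}
    {φ : Π x : M, TangentSpace (𝓡 n) x →L[ℝ] TangentSpace (𝓡 n) x}
    (h : ∀ u v, ContMDiffAt (𝓡 n) 𝓘(ℝ) ∞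
      (fun y ↦ g.inner y (φ y (coordField x₀ u y)) (coordField x₀ v y)) x₀) :
    ContMDiffAt (𝓡 n)
      ((𝓡 n).prod 𝓘(ℝ, EuclideanSpace ℝ (Fin n) →L[ℝ] EuclideanSpace ℝ (Fin n))) ∞
      (fun y ↦ TotalSpace.mk' (EuclideanSpace ℝ (Fin n) →L[ℝ] EuclideanSpace ℝ (Fin n))
        (E := fun y ↦ TangentSpace (𝓡 n) y →L[ℝ] TangentSpace (𝓡 n) y) y (φ y)) x₀ := by
  rw [contMDiffAt_hom_bundle]
  refine ⟨contMDiffAt_id, contMDiffAt_clm fun u ↦ ?_⟩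
  have hu : SmoothFieldAt (fun y ↦ φ y (coordField x₀ u y)) x₀ :=
    g.smoothFieldAt_of_inner (h u)
  refine ((contMDiffAt_section x₀).1 hu).congr_of_eventuallyEq ?_
  filter_upwards [(Trivialization.open_baseSet _).mem_nhds
    (FiberBundle.mem_baseSet_trivializationAt' (F := EuclideanSpace ℝ (Fin n))
      (E := TangentSpace (𝓡 n)) x₀)] with y hy
  exact Trivialization.continuousLinearMapAt_apply_of_mem (R := ℝ) _ hy _

theorem contMDiff_dualConnection [T2Space M] (g : RiemMetric n M) (cov : AffineConnection n M)
    (hcov : cov.ContMDiffCovariantDerivative ∞) :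
    (dualConnection g cov).ContMDiffCovariantDerivative ∞ := by
  refine ⟨⟨fun {Z} hZ ↦ ?_⟩⟩
  have hZ' : ∀ x, SmoothFieldAt Z x := fun x ↦ (hZ x trivial).contMDiffAt Filter.univ_mem
  intro x₀ _
  refine (g.contMDiffAt_hom_of_inner fun u v ↦ ?_).contMDiffWithinAt
  obtain ⟨X, hX, hXe⟩ := exists_global_field x₀ u
  obtain ⟨Y, hY, hYe⟩ := exists_global_field x₀ v
  have hcY : SmoothFieldAt (fun y ↦ cov Y y (X y)) x₀ := by
    have h := hcov.contMDiff.contMDiff (σ := Y) (fun x _ ↦ (hY x).contMDiffWithinAt) x₀ trivial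
    exact (h.contMDiffAt Filter.univ_mem).clm_bundle_apply (hX x₀)
  have h1 := contMDiffAt_mvfderiv_apply (g.contMDiffAt_inner (hY x₀) (hZ' x₀)) (hX x₀)
  have h2 := g.contMDiffAt_inner hcY (hZ' x₀)
  refine (h1.sub h2).congr_of_eventuallyEq ?_
  filter_upwards [hXe, hYe] with y hXy hYy
  have h := dualConnection_spec g cov ((hY y).mdifferentiableAt (by simp))
    ((hZ' y).mdifferentiableAt (by simp)) (X y)
  rw [← hXy, ← hYy, g.symm y]
  change _ = mvfderiv (𝓡 n) _ y (X y) - _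
  rw [h]
  ring

/-! ### Statistical structures -/

/-- A statistical structure `(g, ∇)` on `M`: a smooth Riemannian metric `g` and a smooth torsion-free
affine connection `∇` such that the cubic form `Q(X, Y, Z) = (∇_X g)(Y, Z)` is totally symmetric. -/
structure StatisticalStructure (n : ℕ) (M : Type*) [TopologicalSpace M]
    [ChartedSpace (EuclideanSpace ℝ (Fin n)) M] [IsManifold (𝓡 n) ∞ M] where
  metric : RiemMetric n M
  conn : AffineConnection n M
  smooth : conn.ContMDiffCovariantDerivative ∞
  torsion_eq_zero : conn.torsion = 0
  cubicForm_swap_left (x : M) (X Y Z : TangentSpace (𝓡 n) x) :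
    cubicForm metric conn x X Y Z = cubicForm metric conn x Y X Z
  cubicForm_swap_right (x : M) (X Y Z : TangentSpace (𝓡 n) x) :
    cubicForm metric conn x X Y Z = cubicForm metric conn x X Z Y

/-- The dual statistical structure `(g, ∇*)`. -/
def StatisticalStructure.dual [T2Space M] (S : StatisticalStructure n M) :
    StatisticalStructure n M where
  metric := S.metric
  conn := dualConnection S.metric S.conn
  smooth := contMDiff_dualConnection S.metric S.conn S.smooth
  torsion_eq_zero := torsion_dualConnection S.metric S.conn S.torsion_eq_zero S.cubicForm_swap_left
  cubicForm_swap_left x X Y Z := by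
    simp only [cubicForm, covDerivMetric_dualConnection]
    exact congrArg Neg.neg (S.cubicForm_swap_left x X Y Z)
  cubicForm_swap_right x X Y Z := by
    simp only [cubicForm, covDerivMetric_dualConnection]
    exact congrArg Neg.neg (S.cubicForm_swap_right x X Y Z)

/-! ### Equiaffine structures -/

/-- Fields of alternating `n`-linear forms on the tangent spaces of the `n`-manifold `M`
(no smoothness imposed; continuity in each fibre is automatic in finite dimension). -/
abbrev TopForm (n : ℕ) (M : Type*) [TopologicalSpace M]
    [ChartedSpace (EuclideanSpace ℝ (Fin n)) M] :=
  Π x : M, TangentSpace (𝓡 n) x [⋀^Fin n]→ₗ[ℝ] ℝ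

/-- `η` is a smooth, nowhere vanishing `n`-form on the open set `U`. Smoothness means that
`η(Y₁, …, Yₙ)` is smooth whenever the vector fields `Y₁, …, Yₙ` are. -/
structure IsVolumeFormOn (η : TopForm n M) (U : Set M) : Prop where
  smooth : ∀ x ∈ U, ∀ Y : Fin n → Π x : M, TangentSpace (𝓡 n) x, (∀ i, SmoothFieldAt (Y i) x) →
    ContMDiffAt (𝓡 n) 𝓘(ℝ) ∞ (fun y ↦ η y fun i ↦ Y i y) x
  ne_zero : ∀ x ∈ U, η x ≠ 0

/-- `(∇_X η)(Y₁, …, Yₙ) = X(η(Y₁, …, Yₙ)) - ∑ᵢ η(Y₁, …, ∇_X Yᵢ, …, Yₙ)` at the point `x`. -/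
def covDerivForm (cov : AffineConnection n M) (η : TopForm n M) (x : M)
    (X : TangentSpace (𝓡 n) x) (Y : Fin n → Π x : M, TangentSpace (𝓡 n) x) : ℝ :=
  mvfderiv (𝓡 n) (fun y ↦ η y fun i ↦ Y i y) x X -
    ∑ i, η x (Function.update (fun j ↦ Y j x) i (cov (Y i) x X))

/-- `∇η = 0` on the open set `U`. -/
def IsParallelOn (cov : AffineConnection n M) (η : TopForm n M) (U : Set M) : Prop :=
  ∀ x ∈ U, ∀ (X : TangentSpace (𝓡 n) x) (Y : Fin n → Π x : M, TangentSpace (𝓡 n) x),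
    (∀ i, DifferentiableFieldAt (Y i) x) → covDerivForm cov η x X Y = 0

/-- There is a `∇`-parallel volume form on all of `M`. -/
def StatisticalStructure.HasEquiaffineStructure (S : StatisticalStructure n M) : Prop :=
  ∃ η : TopForm n M, IsVolumeFormOn η Set.univ ∧ IsParallelOn S.conn η Set.univ

/-- Every point of `M` has an open neighbourhood that carries a `∇`-parallel volume form. -/
def StatisticalStructure.HasLocalEquiaffineStructure (S : StatisticalStructure n M) : Prop :=
  ∀ p : M, ∃ U : Set M, IsOpen U ∧ p ∈ U ∧
    ∃ η : TopForm n M, IsVolumeFormOn η U ∧ IsParallelOn S.conn η U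

end StatGeom

end

/-! The metric pairs volume forms: to a nowhere vanishing `η` it assigns the form `η'` with `η'(Y)
η(Z) = det g(Yᵢ, Zⱼ)`. The claim is that `∇η = 0` forces `∇*η' = 0`.

Existence of `η'` is linear algebra in each tangent space (`GramForm.dualForm_mul`): the Gram
determinant is alternating in `Z` as well as in `Y`, and alternating `n`-forms on an `n`-dimensional
space are unique up to scale. Dividing by `η(Z)` for a smooth frame `Z` shows that `η'` is smooth.

For parallelism, differentiate the defining identity along `X`. By Jacobi's formula and duality, the
Gram determinant contributes terms with `∇*_X Yᵢ` in place of `Yᵢ` and terms with `∇_X Zᵢ` in place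
of `Zᵢ` (`RiemMetric.AreDual.mvfderiv_det`). These equal `η(Z) ∑ η'(…, ∇*_X Yᵢ, …)` and `η'(Y) ∑
η(…, ∇_X Zᵢ, …)`. Since `∇η = 0`, the latter is `η'(Y) X(η(Z))`, which cancels against the product
rule; dividing by `η(Z)` leaves `∇*η' = 0`.

Duality is symmetric in the two connections, which gives the converse, and the argument is
pointwise, so the global and local statements are handled together. -/

noncomputable section

namespace StatGeom

/-! ### Linear algebra: Gram determinants and dual top-degree forms. -/

namespace GramForm

variable {V : Type*} [AddCommGroup V] [Module ℝ V] {n : ℕ}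

/-- The alternating form `Y ↦ det (B (Yᵢ, Zⱼ))`. -/
def gramForm (B : V →ₗ[ℝ] V →ₗ[ℝ] ℝ) (Z : Fin n → V) : V [⋀^Fin n]→ₗ[ℝ] ℝ :=
  Matrix.detRowAlternating.compLinearMap (LinearMap.pi fun j ↦ B.flip (Z j))

theorem gramForm_apply (B : V →ₗ[ℝ] V →ₗ[ℝ] ℝ) (Z Y : Fin n → V) :
    gramForm B Z Y = (Matrix.of fun i j ↦ B (Y i) (Z j)).det := rfl

theorem gramForm_flip (B : V →ₗ[ℝ] V →ₗ[ℝ] ℝ) (Z Y : Fin n → V) :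
    gramForm B.flip Y Z = gramForm B Z Y := by
  rw [gramForm_apply, gramForm_apply, ← Matrix.det_transpose]
  rfl

/-- The form dual to `η` with respect to `B`, characterized by
`η'(Y) η(Z) = det (B (Yᵢ, Zⱼ))`; computed in the basis `b`. -/
def dualForm (B : V →ₗ[ℝ] V →ₗ[ℝ] ℝ) (b : Module.Basis (Fin n) ℝ V) (η : V [⋀^Fin n]→ₗ[ℝ] ℝ) :
    V [⋀^Fin n]→ₗ[ℝ] ℝ :=
  (η b)⁻¹ • gramForm B b

/-- As alternating forms in `Z`, both `η` and the Gram determinant are multiples of `b.det`, with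
factors given by their values at `b`. The right side does not mention `b`, so the dual form is
independent of the basis. -/
theorem dualForm_mul (B : V →ₗ[ℝ] V →ₗ[ℝ] ℝ) (b : Module.Basis (Fin n) ℝ V)
    {η : V [⋀^Fin n]→ₗ[ℝ] ℝ} (hη : η ≠ 0) (Y Z : Fin n → V) :
    dualForm B b η Y * η Z = gramForm B Z Y := by
  have hb : η b ≠ 0 := (AlternatingMap.map_basis_ne_zero_iff b η).2 hη
  have h₁ : η Z = η b * b.det Z := congr($(η.eq_smul_basis_det b) Z)
  have h₂ : gramForm B.flip Y Z = gramForm B.flip Y b * b.det Z :=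
    congr($((gramForm B.flip Y).eq_smul_basis_det b) Z)
  rw [gramForm_flip, gramForm_flip] at h₂
  rw [h₁, h₂, dualForm, AlternatingMap.smul_apply, smul_eq_mul]
  field_simp

/-- By Cramer's rule both sides are the trace of `adj(A) B`. -/
theorem sum_det_updateCol_eq_sum_det_updateRow (A B : Matrix (Fin n) (Fin n) ℝ) :
    ∑ i, (A.updateCol i fun k ↦ B k i).det = ∑ i, (A.updateRow i (B i)).det := by
  simp only [← Matrix.cramer_apply, ← Matrix.cramer_transpose_apply,
    Matrix.cramer_eq_adjugate_mulVec, ← Matrix.adjugate_transpose, Matrix.mulVec, dotProduct,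
    Matrix.transpose_apply]
  exact Finset.sum_comm

/-- Leibniz expansion with the factor from column `i` isolated, the shape in which the product rule
delivers the derivative of a determinant. -/
theorem det_updateCol_eq_sum (A : Matrix (Fin n) (Fin n) ℝ) (i : Fin n) (b : Fin n → ℝ) :
    (A.updateCol i b).det = ∑ σ : Equiv.Perm (Fin n),
      ((Equiv.Perm.sign σ : ℤ) : ℝ) * ((∏ j ∈ Finset.univ.erase i, A (σ j) j) * b (σ i)) := by
  rw [Matrix.det_apply']
  refine Finset.sum_congr rfl fun σ _ ↦ ?_
  rw [← Finset.prod_erase_mul _ _ (Finset.mem_univ i), Matrix.updateCol_self]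
  congr 2
  exact Finset.prod_congr rfl fun j hj ↦ Matrix.updateCol_ne (Finset.ne_of_mem_erase hj)

theorem gramForm_update_left (B : V →ₗ[ℝ] V →ₗ[ℝ] ℝ) (Z Y : Fin n → V) (i : Fin n) (v : V) :
    gramForm B Z (Function.update Y i v) =
      ((Matrix.of fun i j ↦ B (Y i) (Z j)).updateRow i fun j ↦ B v (Z j)).det := by
  rw [gramForm_apply]
  congr 1
  ext k l
  rcases eq_or_ne k i with rfl | h <;> simp [*]

theorem gramForm_update_right (B : V →ₗ[ℝ] V →ₗ[ℝ] ℝ) (Z Y : Fin n → V) (i : Fin n) (v : V) :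
    gramForm B (Function.update Z i v) Y =
      ((Matrix.of fun i j ↦ B (Y i) (Z j)).updateCol i fun k ↦ B (Y k) v).det := by
  rw [gramForm_apply]
  congr 1
  ext k l
  rcases eq_or_ne l i with rfl | h <;> simp [*]

end GramForm

open GramForm

variable {n : ℕ} {M : Type*} [TopologicalSpace M] [ChartedSpace (EuclideanSpace ℝ (Fin n)) M]

/-! ### Differentiating determinants of matrix-valued functions. -/

section Det

variable {G : M → Matrix (Fin n) (Fin n) ℝ} {x : M}

theorem hasMFDerivAt_det (hG : ∀ i j, MDifferentiableAt (𝓡 n) 𝓘(ℝ) (fun y ↦ G y i j) x) :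
    HasMFDerivAt (𝓡 n) 𝓘(ℝ) (fun y ↦ (G y).det) x
      (∑ σ : Equiv.Perm (Fin n), ((Equiv.Perm.sign σ : ℤ) : ℝ) •
        ∑ i, (∏ j ∈ Finset.univ.erase i, G x (σ j) j) •
          (mvfderiv (𝓡 n) (fun y ↦ G y (σ i) i) x)) := by
  have h := HasMFDerivAt.sum (t := Finset.univ) fun (σ : Equiv.Perm (Fin n)) _ ↦
    (HasMFDerivAt.prod (t := Finset.univ) fun i _ ↦ (hG (σ i) i).hasMFDerivAt).const_smul
      ((Equiv.Perm.sign σ : ℤ) : ℝ)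
  refine h.congr_of_eventuallyEq (.of_forall fun y ↦ ?_)
  simp [Matrix.det_apply']

theorem mdifferentiableAt_det (hG : ∀ i j, MDifferentiableAt (𝓡 n) 𝓘(ℝ) (fun y ↦ G y i j) x) :
    MDifferentiableAt (𝓡 n) 𝓘(ℝ) (fun y ↦ (G y).det) x :=
  (hasMFDerivAt_det hG).mdifferentiableAt

/-- Jacobi's formula: the derivative of a determinant, column by column. -/
theorem mvfderiv_det_apply (hG : ∀ i j, MDifferentiableAt (𝓡 n) 𝓘(ℝ) (fun y ↦ G y i j) x)
    (X : TangentSpace (𝓡 n) x) :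
    mvfderiv (𝓡 n) (fun y ↦ (G y).det) x X =
      ∑ i, ((G x).updateCol i fun k ↦ mvfderiv (𝓡 n) (fun y ↦ G y k i) x X).det := by
  have h : mvfderiv (𝓡 n) (fun y ↦ (G y).det) x =
      ∑ σ : Equiv.Perm (Fin n), ((Equiv.Perm.sign σ : ℤ) : ℝ) •
        ∑ i, (∏ j ∈ Finset.univ.erase i, G x (σ j) j) •
          mvfderiv (𝓡 n) (fun y ↦ G y (σ i) i) x := (hasMFDerivAt_det hG).mfderiv
  simp only [h, det_updateCol_eq_sum, sum_apply, smul_apply, smul_eq_mul, Finset.mul_sum]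
  exact Finset.sum_comm

theorem contMDiffAt_det (hG : ∀ i j, ContMDiffAt (𝓡 n) 𝓘(ℝ) ∞ (fun y ↦ G y i j) x) :
    ContMDiffAt (𝓡 n) 𝓘(ℝ) ∞ (fun y ↦ (G y).det) x := by
  simp only [Matrix.det_apply']
  exact contMDiffAt_finsetSum fun σ _ ↦
    contMDiffAt_const.mul (contMDiffAt_finsetProd fun i _ ↦ hG (σ i) i)

end Det

/-! ### The dual volume form on the manifold. -/

variable [IsManifold (𝓡 n) ∞ M]

/-- The metric as a bilinear form on a tangent space. -/
def RiemMetric.toBilin (g : RiemMetric n M) (x : M) :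
    TangentSpace (𝓡 n) x →ₗ[ℝ] TangentSpace (𝓡 n) x →ₗ[ℝ] ℝ :=
  ContinuousLinearMap.coeLM ℝ ∘ₗ (g.inner x).toLinearMap

theorem RiemMetric.toBilin_apply (g : RiemMetric n M) (x : M) (u v : TangentSpace (𝓡 n) x) :
    g.toBilin x u v = g.inner x u v := rfl

/-- The standard basis of the model space, as a basis of a tangent space. -/
def modelBasis (x : M) : Module.Basis (Fin n) ℝ (TangentSpace (𝓡 n) x) :=
  (EuclideanSpace.basisFun (Fin n) ℝ).toBasis

theorem exists_smooth_frame (x : M) {η : TangentSpace (𝓡 n) x [⋀^Fin n]→ₗ[ℝ] ℝ} (hη : η ≠ 0) :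
    ∃ Z : Fin n → Π x : M, TangentSpace (𝓡 n) x, (∀ i, SmoothFieldAt (Z i) x) ∧
      (η fun i ↦ Z i x) ≠ 0 := by
  refine ⟨fun i ↦ FiberBundle.extend (EuclideanSpace ℝ (Fin n)) (modelBasis x i),
    fun i ↦ FiberBundle.contMDiffAt_extend .., ?_⟩
  simp only [FiberBundle.extend_apply_self]
  exact (AlternatingMap.map_basis_ne_zero_iff (modelBasis x) η).2 hη

/-- The volume form dual to `η`, with `η'(Y) η(Z) = det g(Yᵢ, Zⱼ)`. -/
def RiemMetric.dualForm (g : RiemMetric n M) (η : TopForm n M) : TopForm n M :=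
  fun x ↦ GramForm.dualForm (g.toBilin x) (modelBasis x) (η x)

theorem RiemMetric.dualForm_mul (g : RiemMetric n M) {η : TopForm n M} {x : M} (hη : η x ≠ 0)
    (Y Z : Fin n → TangentSpace (𝓡 n) x) :
    g.dualForm η x Y * η x Z = gramForm (g.toBilin x) Z Y :=
  GramForm.dualForm_mul _ _ hη Y Z

/-- The bases `modelBasis y` need not vary smoothly with `y`. This local quotient formula replaces
them by the fields `Z`, and all regularity of the dual form is read off from it. -/
theorem RiemMetric.dualForm_eventuallyEq (g : RiemMetric n M) {η : TopForm n M} {x : M}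
    {Z : Fin n → Π x : M, TangentSpace (𝓡 n) x}
    (hc : ContinuousAt (fun y ↦ η y fun i ↦ Z i y) x) (h0 : (η x fun i ↦ Z i x) ≠ 0)
    (Y : Fin n → Π x : M, TangentSpace (𝓡 n) x) :
    (fun y ↦ g.dualForm η y fun i ↦ Y i y) =ᶠ[𝓝 x] fun y ↦
      (Matrix.of fun i j ↦ g.inner y (Y i y) (Z j y)).det / (η y fun i ↦ Z i y) := by
  filter_upwards [hc.eventually_ne h0] with y hy
  rw [eq_div_iff hy, g.dualForm_mul fun h ↦ hy (by rw [h]; rfl)]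
  rfl

theorem RiemMetric.isVolumeFormOn_dualForm (g : RiemMetric n M) {η : TopForm n M} {U : Set M}
    (hη : IsVolumeFormOn η U) : IsVolumeFormOn (g.dualForm η) U where
  smooth x hx Y hY := by
    obtain ⟨Z, hZ, h0⟩ := exists_smooth_frame x (hη.ne_zero x hx)
    have hs := hη.smooth x hx Z hZ
    refine ContMDiffAt.congr_of_eventuallyEq ?_ (g.dualForm_eventuallyEq hs.continuousAt h0 Y)
    exact (contMDiffAt_det fun i j ↦ g.contMDiffAt_inner (hY i) (hZ j)).div₀ hs h0
  ne_zero x hx h := by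
    -- Test on the `g`-dual basis of the model basis: the Gram matrix is then the identity, whose
    -- determinant is `1`.
    choose v hv using fun i ↦ g.exists_inner_eq x ((modelBasis x).coord i)
    have h1 := g.dualForm_mul (hη.ne_zero x hx) v (modelBasis x)
    have h2 : (Matrix.of fun i j ↦ g.toBilin x (v i) (modelBasis x j)) = 1 := by
      ext i j
      simp [RiemMetric.toBilin_apply, hv, Matrix.one_apply, Finsupp.single_apply, eq_comm]
    rw [h, gramForm_apply, h2, Matrix.det_one] at h1
    simp at h1

/-! ### Dual connections and parallel volume forms. -/

/-- `∇` and `∇'` are dual with respect to `g`: `X g(Y, Z) = g(∇_X Y, Z) + g(Y, ∇'_X Z)`. -/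
def RiemMetric.AreDual (g : RiemMetric n M) (cov cov' : AffineConnection n M) : Prop :=
  ∀ (x : M) (Y Z : Π x : M, TangentSpace (𝓡 n) x), DifferentiableFieldAt Y x →
    DifferentiableFieldAt Z x → ∀ X : TangentSpace (𝓡 n) x,
      mvfderiv (𝓡 n) (fun y ↦ g.inner y (Y y) (Z y)) x X =
        g.inner x (cov Y x X) (Z x) + g.inner x (Y x) (cov' Z x X)

theorem areDual_dualConnection (g : RiemMetric n M) (cov : AffineConnection n M) :
    g.AreDual cov (dualConnection g cov) :=
  fun _ _ _ hY hZ X ↦ dualConnection_spec g cov hY hZ X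

theorem RiemMetric.AreDual.symm {g : RiemMetric n M} {cov cov' : AffineConnection n M}
    (h : g.AreDual cov cov') : g.AreDual cov' cov := by
  intro x Y Z hY hZ X
  have e : (fun y ↦ g.inner y (Y y) (Z y)) = fun y ↦ g.inner y (Z y) (Y y) :=
    funext fun y ↦ g.symm y _ _
  rw [e, h x Z Y hZ hY X, g.symm x (Z x), g.symm x _ (Y x), add_comm]

theorem RiemMetric.AreDual.mvfderiv_det {g : RiemMetric n M} {cov cov' : AffineConnection n M}
    (h : g.AreDual cov' cov) {x : M} {Y Z : Fin n → Π x : M, TangentSpace (𝓡 n) x}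
    (hY : ∀ i, DifferentiableFieldAt (Y i) x) (hZ : ∀ i, DifferentiableFieldAt (Z i) x)
    (X : TangentSpace (𝓡 n) x) :
    mvfderiv (𝓡 n) (fun y ↦ (Matrix.of fun i j ↦ g.inner y (Y i y) (Z j y)).det) x X =
      ∑ i, gramForm (g.toBilin x) (fun j ↦ Z j x)
          (Function.update (fun j ↦ Y j x) i (cov' (Y i) x X)) +
        ∑ i, gramForm (g.toBilin x) (Function.update (fun j ↦ Z j x) i (cov (Z i) x X))
          (fun j ↦ Y j x) := by
  rw [mvfderiv_det_apply (G := fun y ↦ Matrix.of fun i j ↦ g.inner y (Y i y) (Z j y))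
    fun i j ↦ g.mdifferentiableAt_inner (hY i) (hZ j)]
  simp only [gramForm_update_left, gramForm_update_right]
  -- Jacobi's formula replaces columns, whereas changing `Yᵢ` replaces a row. After this conversion
  -- each column is a sum of two, as duality predicts for the derivative of `g(Yₖ, Zᵢ)`.
  rw [← sum_det_updateCol_eq_sum_det_updateRow _
    (fun i j ↦ g.toBilin x (cov' (Y i) x X) (Z j x)), ← Finset.sum_add_distrib]
  refine Finset.sum_congr rfl fun i _ ↦ ?_
  rw [← Matrix.det_updateCol_add]
  congr 2
  funext k
  exact h x (Y k) (Z i) (hY k) (hZ i) X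

theorem RiemMetric.AreDual.isParallelOn_dualForm {g : RiemMetric n M}
    {cov cov' : AffineConnection n M} (h : g.AreDual cov cov') {η : TopForm n M} {U : Set M}
    (hη : IsVolumeFormOn η U) (hp : IsParallelOn cov η U) :
    IsParallelOn cov' (g.dualForm η) U := by
  intro x hx X Y hY
  obtain ⟨Z, hZ, h0⟩ := exists_smooth_frame x (hη.ne_zero x hx)
  have hs := hη.smooth x hx Z hZ
  have hZ' : ∀ i, DifferentiableFieldAt (Z i) x := fun i ↦ (hZ i).mdifferentiableAt (by simp)
  have hs' := hs.mdifferentiableAt (by simp)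
  have hdet : MDifferentiableAt (𝓡 n) 𝓘(ℝ)
      (fun y ↦ (Matrix.of fun i j ↦ g.inner y (Y i y) (Z j y)).det) x :=
    mdifferentiableAt_det fun i j ↦ g.mdifferentiableAt_inner (hY i) (hZ' j)
  have he := g.dualForm_eventuallyEq hs.continuousAt h0 Y
  -- The fields `Y` are only differentiable at `x`, so smoothness of the dual form on smooth fields
  -- does not apply; the quotient formula does.
  have hf : MDifferentiableAt (𝓡 n) 𝓘(ℝ) (fun y ↦ g.dualForm η y fun i ↦ Y i y) x :=
    (hdet.div hs' h0).congr_of_eventuallyEq he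
  have hmul : ((fun y ↦ g.dualForm η y fun i ↦ Y i y) * fun y ↦ η y fun i ↦ Z i y) =ᶠ[𝓝 x]
      fun y ↦ (Matrix.of fun i j ↦ g.inner y (Y i y) (Z j y)).det := by
    filter_upwards [hs.continuousAt.eventually_ne h0, he] with y hy hey
    rw [Pi.mul_apply, hey, div_mul_cancel₀ _ hy]
  have hd : mvfderiv (𝓡 n) ((fun y ↦ g.dualForm η y fun i ↦ Y i y) * fun y ↦ η y fun i ↦ Z i y)
      x X = mvfderiv (𝓡 n)
        (fun y ↦ (Matrix.of fun i j ↦ g.inner y (Y i y) (Z j y)).det) x X :=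
    congr($(hmul.mfderiv_eq) X)
  have hpZ := sub_eq_zero.1 (hp x hx X Z hZ')
  rw [mvfderiv_mul hf hs', h.symm.mvfderiv_det hY hZ' X] at hd
  -- Each Gram determinant factors as `η'(·) η(·)`. The sum over the derivatives of the `Zᵢ` is then
  -- `η'(Y) X(η(Z))` by `hpZ`, and `η(Z) ≠ 0` can be cancelled.
  simp only [← g.dualForm_mul (hη.ne_zero x hx), ← Finset.sum_mul, ← Finset.mul_sum] at hd
  rw [← hpZ] at hd
  refine sub_eq_zero.2 (mul_right_cancel₀ h0 ?_)
  simp only [add_apply, smul_apply, smul_eq_mul] at hd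
  linarith

/-- The dual form lives on the same set `U`, so `U = univ` gives the global statement, and the local
one needs no shrinking of neighbourhoods. -/
theorem RiemMetric.AreDual.exists_parallel_volumeForm_iff {g : RiemMetric n M}
    {cov cov' : AffineConnection n M} (h : g.AreDual cov cov') (U : Set M) :
    (∃ η : TopForm n M, IsVolumeFormOn η U ∧ IsParallelOn cov η U) ↔
      ∃ η : TopForm n M, IsVolumeFormOn η U ∧ IsParallelOn cov' η U :=
  ⟨fun ⟨η, hv, hp⟩ ↦ ⟨g.dualForm η, g.isVolumeFormOn_dualForm hv, h.isParallelOn_dualForm hv hp⟩,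
    fun ⟨η, hv, hp⟩ ↦
      ⟨g.dualForm η, g.isVolumeFormOn_dualForm hv, h.symm.isParallelOn_dualForm hv hp⟩⟩

end StatGeom

end

theorem proposition3p1 {n : ℕ} {M : Type*} [TopologicalSpace M] [T2Space M]
    [ChartedSpace (EuclideanSpace ℝ (Fin n)) M] [IsManifold (𝓡 n) ∞ M]
    (S : StatGeom.StatisticalStructure n M) :
    (S.HasEquiaffineStructure ↔ S.dual.HasEquiaffineStructure) ∧
      (S.HasLocalEquiaffineStructure ↔ S.dual.HasLocalEquiaffineStructure) := by
  have h (U : Set M) :=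
    (StatGeom.areDual_dualConnection S.metric S.conn).exists_parallel_volumeForm_iff U
  exact ⟨h _, forall_congr' fun p ↦ exists_congr fun U ↦
    and_congr_right fun _ ↦ and_congr_right fun _ ↦ h U⟩
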